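/- Let $\phi_1,\dots,\phi_k:\mathbb{R}^n\to\mathbb{R}$ be given functions, let $b(z)=(\phi_1(z),\dots,\phi_k(z))^\top$, and for $\theta\in\mathbb{R}^{k\times m}$ let $\phi^\theta(z)=\theta^\top b(z)\in\mathbb{R}^m$. For a symmetric matrix $M\in\mathbb{R}^{(u+v)\times(u+v)}$ with blocks $M_{11}\in\mathbb{R}^{u\times u}$, $M_{12}$, $M_{21}$, $M_{22}\in\mathbb{R}^{v\times v}$, let $$\mathcal{Z}(M)=\left\{Z\in\mathbb{R}^{v\times u}\;\middle|\;\begin{bmatrix}I_u\\ Z\end{bmatrix}^\top M\begin{bmatrix}I_u\\ Z\end{bmatrix}\ge 0\right\}.$$ Let $\Pi\in\mathbb{R}^{(m+T)\times(m+T)}$ be symmetric with $\Pi_{22}<0$ and $\Pi_{11}-\Pi_{12}\Pi_{22}^{-1}\Pi_{21}\ge 0$. Let $z_1,\dots,z_T\in\mathbb{R}^n$, let $\Phi=[\,b(z_1)\ \cdots\ b(z_T)\,]\in\mathbb{R}^{k\times T}$, and let $Y=\hat\theta^\top\Phi+W$ for some $\hat\theta\in\mathbb{R}^{k\times m}$ and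 some $W\in\mathbb{R}^{m\times T}$ with $W^\top\in\mathcal{Z}(\Pi)$. Put $$N=\begin{bmatrix}I_m&Y\\0&-\Phi\end{bmatrix}\Pi\begin{bmatrix}I_m&Y\\0&-\Phi\end{bmatrix}^\top,\qquad \Theta=\mathcal{Z}(N),$$ and suppose that $N$ has at least one positive eigenvalue. Let $z\in\mathbb{R}^n$. Then: 1. For every $\delta\ge 0$, one has $\|\phi^\theta(z)\|_2\le\delta$ for all $\theta\in\Theta$ if and only if there exists $\alpha\ge 0$ such that $$\begin{bmatrix}\delta^2I_m&0&0\\0&0&b(z)\\0&b(z)^\top&1\end{bmatrix}-\alpha\begin{bmatrix}N&0\\0&0\end{bmatrix}\ge 0.\qquad(*)$$ 2. The worst-case norm bound $g(z;\Theta)=\sup_{\theta\in\Theta}\|\phi^\theta(z)\|_2\in[0,\infty]$ satisfies $$g(z;\Theta)=\min\{\delta\ge 0\mid \exists\,\alpha\ge 0\text{ such that }(*)\text{ holds}\},$$ where the minimum is attained if the set is nonempty and is understood as $\infty$ if the set is empty. -/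

import Mathlib

open scoped Matrix

noncomputable section

namespace CautiousOpt

/-- The Schur complement `M | M₂₂ = M₁₁ - M₁₂ M₂₂⁻¹ M₂₁`. It is used only where `M₂₂` is
negative definite, so that the inverse is also the Moore-Penrose pseudoinverse. -/
def schurCompl {u v : ℕ} (M : Matrix (Fin u ⊕ Fin v) (Fin u ⊕ Fin v) ℝ) :
    Matrix (Fin u) (Fin u) ℝ :=
  M.toBlocks₁₁ - M.toBlocks₁₂ * M.toBlocks₂₂⁻¹ * M.toBlocks₂₁

/-- The solution set `𝒵(M)` of the quadratic matrix inequality `[I; Z]ᵀ M [I; Z] ≥ 0`. -/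
def qmiSet {u v : ℕ} (M : Matrix (Fin u ⊕ Fin v) (Fin u ⊕ Fin v) ℝ) :
    Set (Matrix (Fin v) (Fin u) ℝ) :=
  {Z | ((Matrix.fromRows (1 : Matrix (Fin u) (Fin u) ℝ) Z)ᵀ * M *
      Matrix.fromRows (1 : Matrix (Fin u) (Fin u) ℝ) Z).PosSemidef}

/-- The conditions on the matrix of a noise model: `P` symmetric, `P₂₂ < 0`, `P | P₂₂ ≥ 0`. -/
structure IsNoiseModel {m T : ℕ} (P : Matrix (Fin m ⊕ Fin T) (Fin m ⊕ Fin T) ℝ) : Prop where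
  symm : P.IsSymm
  neg : (-P.toBlocks₂₂).PosDef
  schur : (schurCompl P).PosSemidef

/-- The vector `b(z)` of values of the basis functions. -/
def basisVec {n k : ℕ} (φ : Fin k → EuclideanSpace ℝ (Fin n) → ℝ)
    (z : EuclideanSpace ℝ (Fin n)) : Fin k → ℝ :=
  fun i => φ i z

/-- The parameterized function `φ^θ(z) = θᵀ b(z)`. -/
def paramFun {n k m : ℕ} (φ : Fin k → EuclideanSpace ℝ (Fin n) → ℝ)
    (θ : Matrix (Fin k) (Fin m) ℝ) (z : EuclideanSpace ℝ (Fin n)) : EuclideanSpace ℝ (Fin m) :=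
  WithLp.toLp 2 (θᵀ *ᵥ basisVec φ z)

/-- The regressor matrix `Φ = [b(z₁) ⋯ b(z_T)]`. -/
def regressor {n k T : ℕ} (φ : Fin k → EuclideanSpace ℝ (Fin n) → ℝ)
    (zs : Fin T → EuclideanSpace ℝ (Fin n)) : Matrix (Fin k) (Fin T) ℝ :=
  Matrix.of fun i t => basisVec φ (zs t) i

/-- The block matrix `[I Y; 0 -Φ]`. -/
def dataTransform {k m T : ℕ} (Y : Matrix (Fin m) (Fin T) ℝ) (Φ : Matrix (Fin k) (Fin T) ℝ) :
    Matrix (Fin m ⊕ Fin k) (Fin m ⊕ Fin T) ℝ :=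
  Matrix.fromBlocks 1 Y 0 (-Φ)

/-- The data matrix `N = [I Y; 0 -Φ] P [I Y; 0 -Φ]ᵀ`. -/
def dataMatrix {k m T : ℕ} (P : Matrix (Fin m ⊕ Fin T) (Fin m ⊕ Fin T) ℝ)
    (Y : Matrix (Fin m) (Fin T) ℝ) (Φ : Matrix (Fin k) (Fin T) ℝ) :
    Matrix (Fin m ⊕ Fin k) (Fin m ⊕ Fin k) ℝ :=
  dataTransform Y Φ * P * (dataTransform Y Φ)ᵀ

/-- The worst-case norm bound `g(z; Θ) = sup_{θ ∈ Θ} ‖φ^θ(z)‖₂`, with values in `[-∞, ∞]`. -/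
def worstNorm {n k m : ℕ} (φ : Fin k → EuclideanSpace ℝ (Fin n) → ℝ)
    (z : EuclideanSpace ℝ (Fin n)) (Θ : Set (Matrix (Fin k) (Fin m) ℝ)) : EReal :=
  ⨆ θ ∈ Θ, ((‖paramFun φ θ z‖ : ℝ) : EReal)

/-- The matrix `[δ² I, 0, 0; 0, 0, b; 0, bᵀ, 1] - α [N, 0; 0, 0]`. -/
def lmiMatrix {k m : ℕ} (N : Matrix (Fin m ⊕ Fin k) (Fin m ⊕ Fin k) ℝ) (b : Fin k → ℝ)
    (δ α : ℝ) : Matrix ((Fin m ⊕ Fin k) ⊕ Unit) ((Fin m ⊕ Fin k) ⊕ Unit) ℝ :=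
  Matrix.fromBlocks
      (Matrix.fromBlocks (δ ^ 2 • (1 : Matrix (Fin m) (Fin m) ℝ)) 0 0 0)
      (Matrix.fromRows 0 (Matrix.replicateCol Unit b))
      (Matrix.fromCols 0 (Matrix.replicateRow Unit b))
      1
    - α • Matrix.fromBlocks N 0 0 0

/-- The set of all `δ ≥ 0` for which the matrix inequality is feasible for some `α ≥ 0`. -/
def feasibleSet {k m : ℕ} (N : Matrix (Fin m ⊕ Fin k) (Fin m ⊕ Fin k) ℝ) (b : Fin k → ℝ) :
    Set ℝ :=
  {δ | 0 ≤ δ ∧ ∃ α : ℝ, 0 ≤ α ∧ (lmiMatrix N b δ α).PosSemidef}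

end CautiousOpt

end

/-!
A parameter `θ` lies in `𝒵(N)` iff the quadratic form of `N` is nonnegative on the graph
`{(x, θ x)}`, and `‖θᵀ b‖ ≤ δ` iff the form `δ² |x|² - (b ⬝ᵥ y)²` is nonnegative on that graph.
After elimination of its last row and column (`posSemidef_lmiMatrix_iff`), the linear matrix
inequality says that the second form dominates `α` times the first one *everywhere*. So sufficiency
of the inequality is immediate, and necessity is a matrix version of the S-lemma.

It is reduced to the classical homogeneous S-lemma (`exists_nonneg_forall_smul_le`), whose
multiplier is the infimum of the ratio of the two forms. For this the norm bound has to be carried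
over from the graphs of the parameters in `𝒵(N)` to the whole set where the form of `N` is
nonnegative (`sq_le_of_forall_mem_qmiSet`). Completing squares twice, in the noise and in the
parameter, turns the form of `N` into `|F x|² - |A (y - θc x)|²` (`exists_normal_form`). If it is
nonnegative at `(x, y)` with `x ≠ 0`, a correction of `θc` of rank at most one, admissible by the
Cauchy-Schwarz inequality, has `(x, y)` on its graph (`exists_interpolation`). If `x = 0`, then
`A y = 0`, so `𝒵(N)` contains lines in the directions `y vᵀ`, and boundedness of `θᵀ b` along them
forces `b ⬝ᵥ y = 0`.

The second part holds because the feasible `δ` are, by the first part, exactly the real upper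
bounds of the norms over the nonempty set `𝒵(N)`.
-/

namespace CautiousOpt

open Matrix

/-! ### Quadratic forms and the S-lemma -/

section QuadraticForms

variable {ι κ τ : Type*} [Fintype ι] [Fintype κ] [Fintype τ]

lemma dotProduct_conj_mulVec (M : Matrix κ ι ℝ) (P : Matrix κ κ ℝ) (x : ι → ℝ) :
    x ⬝ᵥ (Mᵀ * P * M) *ᵥ x = (M *ᵥ x) ⬝ᵥ P *ᵥ (M *ᵥ x) := by
  rw [← mulVec_mulVec, ← mulVec_mulVec, dotProduct_mulVec, vecMul_transpose]

lemma dotProduct_gram_mulVec (M : Matrix κ ι ℝ) (x : ι → ℝ) :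
    x ⬝ᵥ (Mᵀ * M) *ᵥ x = (M *ᵥ x) ⬝ᵥ (M *ᵥ x) := by
  rw [← mulVec_mulVec, dotProduct_mulVec, vecMul_transpose]

lemma dotProduct_self_nonneg_real (x : ι → ℝ) : 0 ≤ x ⬝ᵥ x := by
  simpa using dotProduct_self_star_nonneg x

lemma posSemidef_iff_real {M : Matrix ι ι ℝ} :
    M.PosSemidef ↔ M.IsSymm ∧ ∀ x : ι → ℝ, 0 ≤ x ⬝ᵥ M *ᵥ x := by
  rw [posSemidef_iff_dotProduct_mulVec]
  simp [IsHermitian, IsSymm, conjTranspose_eq_transpose_of_trivial]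

lemma _root_.Matrix.PosSemidef.exists_eq_transpose_mul_self {M : Matrix ι ι ℝ}
    (hM : M.PosSemidef) : ∃ F : Matrix ι ι ℝ, M = Fᵀ * F := by
  classical
  open scoped MatrixOrder in
  obtain ⟨F, hF⟩ := CStarAlgebra.nonneg_iff_eq_star_mul_self.mp hM.nonneg
  exact ⟨F, by rw [hF, star_eq_conjTranspose, conjTranspose_eq_transpose_of_trivial]⟩

lemma dotProduct_sq_le (x y : ι → ℝ) : (x ⬝ᵥ y) ^ 2 ≤ (x ⬝ᵥ x) * (y ⬝ᵥ y) := by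
  simpa [dotProduct, pow_two] using Finset.sum_mul_sq_le_sq_mul_sq Finset.univ x y

lemma quad_add_smul {M : Matrix ι ι ℝ} (hM : M.IsSymm) (x y : ι → ℝ) (t : ℝ) :
    (x + t • y) ⬝ᵥ M *ᵥ (x + t • y) =
      x ⬝ᵥ M *ᵥ x + 2 * t * (x ⬝ᵥ M *ᵥ y) + t ^ 2 * (y ⬝ᵥ M *ᵥ y) := by
  have h : y ⬝ᵥ M *ᵥ x = x ⬝ᵥ M *ᵥ y := by
    rw [dotProduct_mulVec, ← mulVec_transpose, hM.eq, dotProduct_comm]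
  simp only [mulVec_add, mulVec_smul, dotProduct_add, add_dotProduct, smul_dotProduct,
    dotProduct_smul, smul_eq_mul, h]
  ring

/-- The quadratic `a + 2 b t + c t ^ 2` with `a < 0 < c` has a negative and a positive root, with
product `a / c`. -/
lemma exists_roots_of_neg_of_pos {a b c : ℝ} (ha : a < 0) (hc : 0 < c) :
    ∃ s t : ℝ, s < 0 ∧ 0 < t ∧ a + 2 * s * b + s ^ 2 * c = 0 ∧
      a + 2 * t * b + t ^ 2 * c = 0 ∧ s * t * c = a := by
  have hD : 0 ≤ b ^ 2 - a * c := by nlinarith [mul_pos (neg_pos.2 ha) hc, sq_nonneg b]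
  have hr := Real.sq_sqrt hD
  have hr0 := Real.sqrt_nonneg (b ^ 2 - a * c)
  set r := √(b ^ 2 - a * c)
  have hac : a * c < 0 := mul_neg_of_neg_of_pos ha hc
  have hlt := abs_lt_of_sq_lt_sq (by nlinarith : b ^ 2 < r ^ 2) hr0
  rw [abs_lt] at hlt
  refine ⟨(-b - r) / c, (-b + r) / c, div_neg_of_neg_of_pos (by linarith) hc,
    div_pos (by linarith) hc, ?_, ?_, ?_⟩ <;> field_simp <;> linarith

/-- Along the line through `x` and `y` the form of `B` vanishes on both sides of `x`; nonnegativity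
of the form of `A` at the two zeros bounds its value at `x` in terms of its value at `y`. -/
lemma quad_mul_le_quad_mul {A B : Matrix ι ι ℝ} (hA : A.IsSymm) (hB : B.IsSymm)
    (h : ∀ x : ι → ℝ, 0 ≤ x ⬝ᵥ B *ᵥ x → 0 ≤ x ⬝ᵥ A *ᵥ x) {x y : ι → ℝ}
    (hx : x ⬝ᵥ B *ᵥ x < 0) (hy : 0 < y ⬝ᵥ B *ᵥ y) :
    (y ⬝ᵥ A *ᵥ y) * (x ⬝ᵥ B *ᵥ x) ≤ (x ⬝ᵥ A *ᵥ x) * (y ⬝ᵥ B *ᵥ y) := by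
  obtain ⟨s, t, hs, ht, hs0, ht0, hst⟩ :=
    exists_roots_of_neg_of_pos (b := x ⬝ᵥ B *ᵥ y) hx hy
  have h1 := h (x + s • y) (by rw [quad_add_smul hB, hs0])
  have h2 := h (x + t • y) (by rw [quad_add_smul hB, ht0])
  rw [quad_add_smul hA] at h1 h2
  set a := x ⬝ᵥ A *ᵥ x
  set c := y ⬝ᵥ A *ᵥ y
  have key : 0 ≤ (t - s) * (a - s * t * c) := by
    nlinarith [mul_nonneg ht.le h1, mul_nonneg (neg_nonneg.2 hs.le) h2]
  have := nonneg_of_mul_nonneg_right key (by linarith)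
  rw [← hst]
  nlinarith [mul_nonneg this hy.le]

/-- **S-lemma** for homogeneous quadratic forms: if `A` is nonnegative wherever `B` is, and `B` is
positive somewhere, then `A` dominates a nonnegative multiple of `B`. -/
theorem exists_nonneg_forall_smul_le {A B : Matrix ι ι ℝ} (hA : A.IsSymm) (hB : B.IsSymm)
    (hpos : ∃ y : ι → ℝ, 0 < y ⬝ᵥ B *ᵥ y)
    (h : ∀ x : ι → ℝ, 0 ≤ x ⬝ᵥ B *ᵥ x → 0 ≤ x ⬝ᵥ A *ᵥ x) :
    ∃ α : ℝ, 0 ≤ α ∧ ∀ x : ι → ℝ, α * (x ⬝ᵥ B *ᵥ x) ≤ x ⬝ᵥ A *ᵥ x := by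
  -- The multiplier is the least ratio of the two forms over the vectors where that of `B` is
  -- positive.
  let ratio : {y : ι → ℝ // 0 < y ⬝ᵥ B *ᵥ y} → ℝ := fun y =>
    (y.1 ⬝ᵥ A *ᵥ y.1) / (y.1 ⬝ᵥ B *ᵥ y.1)
  have hratio : ∀ y, 0 ≤ ratio y := fun y => div_nonneg (h _ y.2.le) y.2.le
  have hbdd : BddBelow (Set.range ratio) := ⟨0, by rintro _ ⟨y, rfl⟩; exact hratio y⟩
  obtain ⟨y₀, hy₀⟩ := hpos
  have : Nonempty {y : ι → ℝ // 0 < y ⬝ᵥ B *ᵥ y} := ⟨⟨y₀, hy₀⟩⟩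
  refine ⟨⨅ y, ratio y, le_ciInf hratio, fun x => ?_⟩
  rcases lt_trichotomy (x ⬝ᵥ B *ᵥ x) 0 with hx | hx | hx
  · rw [← div_le_iff_of_neg hx]
    refine le_ciInf fun y => ?_
    rw [div_le_iff_of_neg hx]
    have := quad_mul_le_quad_mul hA hB h hx y.2
    simp only [ratio]
    rwa [div_mul_eq_mul_div, div_le_iff₀ y.2]
  · rw [hx, mul_zero]
    exact h x hx.ge
  · rw [← le_div_iff₀ hx]
    exact ciInf_le hbdd ⟨x, hx⟩

/-! ### Least squares and rank-one interpolation -/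

/-- The normal equations of a linear least-squares problem are solvable, because `Aᵀ * A` and `Aᵀ`
have the same range. -/
lemma exists_normal_equations {σ : Type*} (A : Matrix τ κ ℝ) (K : Matrix τ σ ℝ) :
    ∃ θ : Matrix κ σ ℝ, Aᵀ * A * θ = Aᵀ * K := by
  classical
  have hle : LinearMap.range (Aᵀ * A).mulVecLin ≤ LinearMap.range Aᵀ.mulVecLin := by
    rw [mulVecLin_mul]
    exact LinearMap.range_comp_le_range _ _
  have heq := Submodule.eq_of_le_of_finrank_eq hle
    ((rank_transpose_mul_self A).trans (rank_transpose A).symm)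
  have hcol : ∀ j, ∃ t : κ → ℝ, (Aᵀ * A) *ᵥ t = Aᵀ *ᵥ K.col j := fun j => by
    have : Aᵀ *ᵥ K.col j ∈ LinearMap.range (Aᵀ * A).mulVecLin := by
      rw [heq]
      exact ⟨_, rfl⟩
    exact this
  choose t ht using hcol
  refine ⟨(Matrix.of t)ᵀ, ?_⟩
  ext i j
  exact congrFun (ht j) i

/-- A quadratic matrix inequality `|A H v| ≤ |F v|` for all `v` has a solution `H` interpolating
`H x = h` as soon as this is consistent with the inequality at `v = x ≠ 0`. The solution has rank
at most one. -/
lemma exists_interpolation (F : Matrix τ ι ℝ) {σ : Type*} [Fintype σ] (A : Matrix σ κ ℝ)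
    {x : ι → ℝ} (hx : x ≠ 0) (h : κ → ℝ)
    (hle : (A *ᵥ h) ⬝ᵥ (A *ᵥ h) ≤ (F *ᵥ x) ⬝ᵥ (F *ᵥ x)) :
    ∃ H : Matrix κ ι ℝ, H *ᵥ x = h ∧
      ∀ v, (A *ᵥ H *ᵥ v) ⬝ᵥ (A *ᵥ H *ᵥ v) ≤ (F *ᵥ v) ⬝ᵥ (F *ᵥ v) := by
  rcases (dotProduct_self_nonneg_real (F *ᵥ x)).eq_or_lt with hs | hs
  · have hAh : A *ᵥ h = 0 := by
      rw [← dotProduct_self_eq_zero]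
      exact le_antisymm (hs ▸ hle) (dotProduct_self_nonneg_real _)
    have hxx : x ⬝ᵥ x ≠ 0 := by rwa [Ne, dotProduct_self_eq_zero]
    refine ⟨vecMulVec h ((x ⬝ᵥ x)⁻¹ • x), ?_, fun v => ?_⟩
    · rw [vecMulVec_mulVec, smul_dotProduct, smul_eq_mul, inv_mul_cancel₀ hxx]
      simp
    · rw [vecMulVec_mulVec]
      simp [mulVec_smul, hAh, dotProduct_self_nonneg_real]
  · set s := (F *ᵥ x) ⬝ᵥ (F *ᵥ x) with hsdef
    refine ⟨vecMulVec h (s⁻¹ • (Fᵀ *ᵥ (F *ᵥ x))), ?_, fun v => ?_⟩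
    · rw [vecMulVec_mulVec, smul_dotProduct, mulVec_transpose, ← dotProduct_mulVec, ← hsdef,
        smul_eq_mul, inv_mul_cancel₀ hs.ne']
      simp
    · rw [vecMulVec_mulVec, smul_dotProduct, mulVec_transpose, ← dotProduct_mulVec]
      simp only [op_smul_eq_smul, mulVec_smul, smul_dotProduct, dotProduct_smul, smul_eq_mul]
      set p := (F *ᵥ x) ⬝ᵥ (F *ᵥ v)
      have hcs : p ^ 2 ≤ s * ((F *ᵥ v) ⬝ᵥ (F *ᵥ v)) := dotProduct_sq_le _ _
      calc s⁻¹ * p * (s⁻¹ * p * ((A *ᵥ h) ⬝ᵥ (A *ᵥ h)))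
          = (s⁻¹ * p) ^ 2 * ((A *ᵥ h) ⬝ᵥ (A *ᵥ h)) := by ring
        _ ≤ (s⁻¹ * p) ^ 2 * s := by gcongr
        _ = s⁻¹ * p ^ 2 := by field_simp
        _ ≤ s⁻¹ * (s * ((F *ᵥ v) ⬝ᵥ (F *ᵥ v))) := by gcongr
        _ = (F *ᵥ v) ⬝ᵥ (F *ᵥ v) := by field_simp

end QuadraticForms

/-! ### The data matrix and its normal form -/

section DataMatrix

variable {m k T : ℕ}

lemma mem_qmiSet_iff {u v : ℕ} {M : Matrix (Fin u ⊕ Fin v) (Fin u ⊕ Fin v) ℝ} (hM : M.IsSymm)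
    (Z : Matrix (Fin v) (Fin u) ℝ) :
    Z ∈ qmiSet M ↔ ∀ x : Fin u → ℝ,
      0 ≤ Sum.elim x (Z *ᵥ x) ⬝ᵥ M *ᵥ Sum.elim x (Z *ᵥ x) := by
  have hsymm : ((fromRows (1 : Matrix (Fin u) (Fin u) ℝ) Z)ᵀ * M *
      fromRows (1 : Matrix (Fin u) (Fin u) ℝ) Z).IsSymm := by
    simp only [IsSymm, transpose_mul, transpose_transpose, hM.eq, Matrix.mul_assoc]
  simp only [qmiSet, Set.mem_ofPred_eq, posSemidef_iff_real, hsymm, true_and,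
    dotProduct_conj_mulVec, fromRows_mulVec, one_mulVec]

lemma dataMatrix_isSymm {P : Matrix (Fin m ⊕ Fin T) (Fin m ⊕ Fin T) ℝ} (hP : P.IsSymm)
    (Y : Matrix (Fin m) (Fin T) ℝ) (Φ : Matrix (Fin k) (Fin T) ℝ) :
    (dataMatrix P Y Φ).IsSymm := by
  simp only [dataMatrix, IsSymm, transpose_mul, transpose_transpose, hP.eq, Matrix.mul_assoc]

lemma quad_dataMatrix (P : Matrix (Fin m ⊕ Fin T) (Fin m ⊕ Fin T) ℝ)
    (Y : Matrix (Fin m) (Fin T) ℝ) (Φ : Matrix (Fin k) (Fin T) ℝ)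
    (x : Fin m → ℝ) (y : Fin k → ℝ) :
    Sum.elim x y ⬝ᵥ dataMatrix P Y Φ *ᵥ Sum.elim x y =
      Sum.elim x (Yᵀ *ᵥ x - Φᵀ *ᵥ y) ⬝ᵥ P *ᵥ Sum.elim x (Yᵀ *ᵥ x - Φᵀ *ᵥ y) := by
  have h := dotProduct_conj_mulVec (dataTransform Y Φ)ᵀ P (Sum.elim x y)
  rw [transpose_transpose] at h
  rw [dataMatrix, h]
  have : (dataTransform Y Φ)ᵀ *ᵥ Sum.elim x y = Sum.elim x (Yᵀ *ᵥ x - Φᵀ *ᵥ y) := by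
    simp [dataTransform, fromBlocks_transpose, fromBlocks_mulVec, sub_eq_add_neg, neg_mulVec]
  rw [this]

/-- A parameter generating the data with admissible noise is consistent with the data. -/
lemma mem_qmiSet_dataMatrix {P : Matrix (Fin m ⊕ Fin T) (Fin m ⊕ Fin T) ℝ} (hP : P.IsSymm)
    {θ : Matrix (Fin k) (Fin m) ℝ} {W : Matrix (Fin m) (Fin T) ℝ} (hW : Wᵀ ∈ qmiSet P)
    (Φ : Matrix (Fin k) (Fin T) ℝ) : θ ∈ qmiSet (dataMatrix P (θᵀ * Φ + W) Φ) := by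
  rw [mem_qmiSet_iff (dataMatrix_isSymm hP _ _)]
  rw [mem_qmiSet_iff hP] at hW
  intro x
  rw [quad_dataMatrix]
  convert hW x using 3 <;>
  simp [add_mulVec, mulVec_mulVec]

/-- Completion of the square in the noise variable; `B` is a square root of `-P₂₂`, and `-C x` is
the maximizer of the form for given `x`. -/
lemma exists_quad_noise {P : Matrix (Fin m ⊕ Fin T) (Fin m ⊕ Fin T) ℝ} (hP : P.IsSymm)
    (hneg : (-P.toBlocks₂₂).PosDef) :
    ∃ (C : Matrix (Fin T) (Fin m) ℝ) (B : Matrix (Fin T) (Fin T) ℝ),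
      ∀ (x : Fin m → ℝ) (w : Fin T → ℝ), Sum.elim x w ⬝ᵥ P *ᵥ Sum.elim x w =
        x ⬝ᵥ schurCompl P *ᵥ x - (B *ᵥ (C *ᵥ x + w)) ⬝ᵥ (B *ᵥ (C *ᵥ x + w)) := by
  obtain ⟨B, hB⟩ := hneg.posSemidef.exists_eq_transpose_mul_self
  have hD : P.toBlocks₂₂ = -(Bᵀ * B) := by rw [← hB, neg_neg]
  have hu : IsUnit P.toBlocks₂₂ := by simpa using hneg.isUnit.neg
  have := hu.invertible
  have hherm : P.toBlocks₂₂.IsHermitian := by simpa using hneg.isHermitian.neg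
  have h21 : P.toBlocks₂₁ = P.toBlocks₁₂ᴴ := by
    ext i j
    exact hP.apply _ _
  refine ⟨P.toBlocks₂₂⁻¹ * P.toBlocks₂₁, B, fun x w => ?_⟩
  have h := schur_complement_eq₂₂ P.toBlocks₁₁ P.toBlocks₁₂ x w hherm
  rw [← h21, fromBlocks_toBlocks] at h
  simp only [star_trivial, ← dotProduct_mulVec] at h
  rw [h, schurCompl]
  generalize (P.toBlocks₂₂⁻¹ * P.toBlocks₂₁) *ᵥ x + w = e
  rw [hD, neg_mulVec, dotProduct_neg, dotProduct_gram_mulVec]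
  ring

/-- Normal form of the data matrix: completing the square in `y` around `θc *ᵥ x`, where `θc` is a
least-squares estimate, splits its quadratic form into a difference of two squared norms. The
remaining form in `x` is nonnegative because some parameter is consistent with the data. -/
lemma exists_normal_form {P : Matrix (Fin m ⊕ Fin T) (Fin m ⊕ Fin T) ℝ} (hP : P.IsSymm)
    (hneg : (-P.toBlocks₂₂).PosDef) (hS : (schurCompl P).IsSymm)
    (Y : Matrix (Fin m) (Fin T) ℝ) (Φ : Matrix (Fin k) (Fin T) ℝ)
    (hne : (qmiSet (dataMatrix P Y Φ)).Nonempty) :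
    ∃ (F : Matrix (Fin m) (Fin m) ℝ) (A : Matrix (Fin T) (Fin k) ℝ)
      (θc : Matrix (Fin k) (Fin m) ℝ), ∀ (x : Fin m → ℝ) (y : Fin k → ℝ),
        Sum.elim x y ⬝ᵥ dataMatrix P Y Φ *ᵥ Sum.elim x y =
          (F *ᵥ x) ⬝ᵥ (F *ᵥ x) -
            (A *ᵥ (y - θc *ᵥ x)) ⬝ᵥ (A *ᵥ (y - θc *ᵥ x)) := by
  obtain ⟨C, B, hCB⟩ := exists_quad_noise hP hneg
  set A := B * Φᵀ with hA
  set K := B * (C + Yᵀ) with hK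
  obtain ⟨θc, hθc⟩ := exists_normal_equations A K
  set E := K - A * θc with hE
  have hAE : Aᵀ * E = 0 := by rw [hE, Matrix.mul_sub, ← Matrix.mul_assoc Aᵀ A, hθc, sub_self]
  have hq : ∀ (x : Fin m → ℝ) (y : Fin k → ℝ),
      Sum.elim x y ⬝ᵥ dataMatrix P Y Φ *ᵥ Sum.elim x y =
        x ⬝ᵥ (schurCompl P - Eᵀ * E) *ᵥ x -
          (A *ᵥ (y - θc *ᵥ x)) ⬝ᵥ (A *ᵥ (y - θc *ᵥ x)) := by
    intro x y
    have hsplit : B *ᵥ (C *ᵥ x + (Yᵀ *ᵥ x - Φᵀ *ᵥ y)) = E *ᵥ x - A *ᵥ (y - θc *ᵥ x) := by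
      simp only [hE, hA, hK, sub_mulVec, mulVec_sub, mulVec_add, add_mulVec, ← mulVec_mulVec]
      abel
    -- The residual `E` of the least-squares problem is orthogonal to the range of `A`.
    have horth : ∀ d : Fin k → ℝ, (A *ᵥ d) ⬝ᵥ (E *ᵥ x) = 0 := fun d => by
      rw [dotProduct_comm, dotProduct_mulVec, ← mulVec_transpose, mulVec_mulVec, hAE]
      simp
    rw [quad_dataMatrix, hCB, hsplit, sub_mulVec (schurCompl P), dotProduct_sub x,
      dotProduct_gram_mulVec, sub_dotProduct, dotProduct_sub, dotProduct_sub, horth,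
      dotProduct_comm (E *ᵥ x) (A *ᵥ _), horth]
    ring
  obtain ⟨θ, hθ⟩ := hne
  rw [mem_qmiSet_iff (dataMatrix_isSymm hP _ _)] at hθ
  have hpsd : (schurCompl P - Eᵀ * E).PosSemidef := by
    refine posSemidef_iff_real.2 ⟨hS.sub (by simp [IsSymm]), fun x => ?_⟩
    have h := hθ x
    rw [hq] at h
    linarith [dotProduct_self_nonneg_real (A *ᵥ (θ *ᵥ x - θc *ᵥ x))]
  obtain ⟨F, hF⟩ := hpsd.exists_eq_transpose_mul_self
  refine ⟨F, A, θc, fun x y => ?_⟩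
  rw [hq, hF, dotProduct_gram_mulVec]

end DataMatrix

/-! ### The linear matrix inequality -/

section LMI

variable {m k n : ℕ}

/-- The matrix of the quadratic form `(x, y) ↦ δ² |x|² - (b ⬝ᵥ y)²`, whose nonnegativity on the
graph of `θ` says that `θᵀ b` has norm at most `δ`. -/
def costMatrix (m : ℕ) (b : Fin k → ℝ) (δ : ℝ) :
    Matrix (Fin m ⊕ Fin k) (Fin m ⊕ Fin k) ℝ :=
  fromBlocks (δ ^ 2 • (1 : Matrix (Fin m) (Fin m) ℝ)) 0 0 (-vecMulVec b b)

lemma costMatrix_isSymm (b : Fin k → ℝ) (δ : ℝ) : (costMatrix m b δ).IsSymm := by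
  simp [costMatrix, IsSymm, fromBlocks_transpose, transpose_vecMulVec]

lemma quad_costMatrix (b : Fin k → ℝ) (δ : ℝ) (x : Fin m → ℝ) (y : Fin k → ℝ) :
    Sum.elim x y ⬝ᵥ costMatrix m b δ *ᵥ Sum.elim x y = δ ^ 2 * (x ⬝ᵥ x) - (b ⬝ᵥ y) ^ 2 := by
  simp [costMatrix, fromBlocks_mulVec, smul_mulVec, neg_mulVec, vecMulVec_mulVec,
    dotProduct_comm y b]
  ring

lemma quad_lmiMatrix (N : Matrix (Fin m ⊕ Fin k) (Fin m ⊕ Fin k) ℝ) (b : Fin k → ℝ) (δ α : ℝ)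
    (x : Fin m → ℝ) (y : Fin k → ℝ) (t : Unit → ℝ) :
    Sum.elim (Sum.elim x y) t ⬝ᵥ lmiMatrix N b δ α *ᵥ Sum.elim (Sum.elim x y) t =
      δ ^ 2 * (x ⬝ᵥ x) + 2 * t () * (b ⬝ᵥ y) + t () ^ 2
        - α * (Sum.elim x y ⬝ᵥ N *ᵥ Sum.elim x y) := by
  have h1 : (replicateCol Unit b *ᵥ t) = t () • b := by
    ext i; simp [mulVec, dotProduct, mul_comm]
  have h2 : (replicateRow Unit b *ᵥ y) = fun _ => b ⬝ᵥ y := by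
    ext i; simp [mulVec, dotProduct]
  have h3 : t ⬝ᵥ (fun _ => b ⬝ᵥ y) = t () * (b ⬝ᵥ y) := by simp [dotProduct]
  have h4 : t ⬝ᵥ t = t () ^ 2 := by simp [dotProduct, pow_two]
  simp [lmiMatrix, sub_mulVec, fromBlocks_mulVec, smul_mulVec, fromRows_mulVec,
    h1, h2, h3, h4, dotProduct_comm y b]
  ring

lemma lmiMatrix_isSymm {N : Matrix (Fin m ⊕ Fin k) (Fin m ⊕ Fin k) ℝ} (hN : N.IsSymm)
    (b : Fin k → ℝ) (δ α : ℝ) : (lmiMatrix N b δ α).IsSymm := by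
  simp [lmiMatrix, IsSymm, fromBlocks_transpose, hN.eq, transpose_fromRows, transpose_fromCols]

/-- Elimination of the last row and column of the linear matrix inequality, by a Schur complement
with respect to the corner entry `1`. -/
lemma posSemidef_lmiMatrix_iff {N : Matrix (Fin m ⊕ Fin k) (Fin m ⊕ Fin k) ℝ} (hN : N.IsSymm)
    (b : Fin k → ℝ) (δ α : ℝ) :
    (lmiMatrix N b δ α).PosSemidef ↔ ∀ (x : Fin m → ℝ) (y : Fin k → ℝ),
      α * (Sum.elim x y ⬝ᵥ N *ᵥ Sum.elim x y) ≤ δ ^ 2 * (x ⬝ᵥ x) - (b ⬝ᵥ y) ^ 2 := by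
  rw [posSemidef_iff_real, and_iff_right (lmiMatrix_isSymm hN b δ α)]
  constructor
  · intro h x y
    -- The minimizer of the form in the last coordinate.
    have := h (Sum.elim (Sum.elim x y) fun _ => -(b ⬝ᵥ y))
    rw [quad_lmiMatrix] at this
    linarith
  · intro h v
    obtain ⟨x, y, t, rfl⟩ : ∃ x y t, v = Sum.elim (Sum.elim x y) t :=
      ⟨_, _, _, by rw [Sum.elim_comp_inl_inr (v ∘ Sum.inl), Sum.elim_comp_inl_inr v]⟩
    rw [quad_lmiMatrix]
    nlinarith [h x y, sq_nonneg (t () + b ⬝ᵥ y)]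

/-- The norm of `θᵀ b` is bounded by testing against all vectors `x`. -/
lemma norm_paramFun_le_iff (φ : Fin k → EuclideanSpace ℝ (Fin n) → ℝ)
    (θ : Matrix (Fin k) (Fin m) ℝ) (z : EuclideanSpace ℝ (Fin n)) {δ : ℝ} (hδ : 0 ≤ δ) :
    ‖paramFun φ θ z‖ ≤ δ ↔
      ∀ x : Fin m → ℝ, (basisVec φ z ⬝ᵥ θ *ᵥ x) ^ 2 ≤ δ ^ 2 * (x ⬝ᵥ x) := by
  set b := basisVec φ z
  have hnorm : ‖paramFun φ θ z‖ ^ 2 = (θᵀ *ᵥ b) ⬝ᵥ (θᵀ *ᵥ b) := by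
    rw [EuclideanSpace.real_norm_sq_eq]
    simp [paramFun, dotProduct, pow_two, b]
  have hdual : ∀ x : Fin m → ℝ, b ⬝ᵥ θ *ᵥ x = (θᵀ *ᵥ b) ⬝ᵥ x := fun x => by
    rw [dotProduct_mulVec, mulVec_transpose]
  rw [← sq_le_sq₀ (norm_nonneg _) hδ, hnorm]
  simp only [hdual]
  set p := θᵀ *ᵥ b
  constructor
  · intro h x
    exact (dotProduct_sq_le p x).trans
      (mul_le_mul_of_nonneg_right h (dotProduct_self_nonneg_real x))
  · intro h
    rcases (dotProduct_self_nonneg_real p).eq_or_lt with h0 | h0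
    · rw [← h0]; positivity
    · have := h p
      rw [pow_two] at this
      exact le_of_mul_le_mul_right this h0

/-! ### From the parameter set to the quadratic form, and the worst-case norm -/

/-- If every parameter in `𝒵(N)` satisfies the bound `δ`, then the form `δ² |x|² - (b ⬝ᵥ y)²` is
nonnegative wherever that of `N` is: for `x ≠ 0` such a pair `(x, y)` lies on the graph of a
parameter in `𝒵(N)`, and for `x = 0` the vector `y` spans directions in which `𝒵(N)` is
unbounded. -/
lemma sq_le_of_forall_mem_qmiSet {τ σ : Type*} [Fintype τ] [Fintype σ]
    {N : Matrix (Fin m ⊕ Fin k) (Fin m ⊕ Fin k) ℝ}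
    (hN : N.IsSymm) (hpos : ∃ v, 0 < v ⬝ᵥ N *ᵥ v) {F : Matrix τ (Fin m) ℝ}
    {A : Matrix σ (Fin k) ℝ} {θc : Matrix (Fin k) (Fin m) ℝ}
    (hform : ∀ (x : Fin m → ℝ) (y : Fin k → ℝ), Sum.elim x y ⬝ᵥ N *ᵥ Sum.elim x y =
      (F *ᵥ x) ⬝ᵥ (F *ᵥ x) - (A *ᵥ (y - θc *ᵥ x)) ⬝ᵥ (A *ᵥ (y - θc *ᵥ x)))
    {b : Fin k → ℝ} {δ : ℝ}
    (hb : ∀ θ ∈ qmiSet N, ∀ x : Fin m → ℝ, (b ⬝ᵥ θ *ᵥ x) ^ 2 ≤ δ ^ 2 * (x ⬝ᵥ x))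
    {x : Fin m → ℝ} {y : Fin k → ℝ} (hxy : 0 ≤ Sum.elim x y ⬝ᵥ N *ᵥ Sum.elim x y) :
    (b ⬝ᵥ y) ^ 2 ≤ δ ^ 2 * (x ⬝ᵥ x) := by
  have hmem : ∀ H : Matrix (Fin k) (Fin m) ℝ,
      (∀ v, (A *ᵥ H *ᵥ v) ⬝ᵥ (A *ᵥ H *ᵥ v) ≤ (F *ᵥ v) ⬝ᵥ (F *ᵥ v)) → θc + H ∈ qmiSet N := by
    intro H hH
    refine (mem_qmiSet_iff hN _).2 fun v => ?_
    rw [hform, add_mulVec, add_sub_cancel_left]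
    exact sub_nonneg.2 (hH v)
  rw [hform, sub_nonneg] at hxy
  by_cases hx : x = 0
  · subst hx
    have hAy : A *ᵥ y = 0 := by
      rw [← dotProduct_self_eq_zero]
      refine le_antisymm ?_ (dotProduct_self_nonneg_real _)
      simpa using hxy
    -- Positivity of `N` somewhere provides a nonzero `v`, that is, excludes `m = 0`.
    obtain ⟨v, hv⟩ : ∃ v : Fin m → ℝ, v ≠ 0 := by
      obtain ⟨w, hw⟩ := hpos
      rw [← Sum.elim_comp_inl_inr w, hform] at hw
      refine ⟨w ∘ Sum.inl, fun h0 => ?_⟩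
      rw [h0] at hw
      have := dotProduct_self_nonneg_real (A *ᵥ (w ∘ Sum.inr - θc *ᵥ 0))
      simp only [mulVec_zero, dotProduct_zero] at hw this
      linarith
    have hvv : v ⬝ᵥ v ≠ 0 := by rwa [Ne, dotProduct_self_eq_zero]
    have hline : ∀ t : ℝ, (b ⬝ᵥ θc *ᵥ v + t * ((v ⬝ᵥ v) * (b ⬝ᵥ y))) ^ 2 ≤
        δ ^ 2 * (v ⬝ᵥ v) := fun t => by
      have h := hb _ (hmem (t • vecMulVec y v) fun u => by
        simp [smul_mulVec, vecMulVec_mulVec, mulVec_smul, hAy, dotProduct_self_nonneg_real]) v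
      simpa [add_mulVec, smul_mulVec, vecMulVec_mulVec, dotProduct_add] using h
    have hby : b ⬝ᵥ y = 0 := by
      by_contra hne
      have hc : (v ⬝ᵥ v) * (b ⬝ᵥ y) ≠ 0 := mul_ne_zero hvv hne
      -- Move along the line until the linear functional reaches the squared bound plus one.
      have h := hline ((δ ^ 2 * (v ⬝ᵥ v) + 1 - b ⬝ᵥ θc *ᵥ v) / ((v ⬝ᵥ v) * (b ⬝ᵥ y)))
      rw [div_mul_cancel₀ _ hc, add_sub_cancel] at h
      nlinarith [mul_nonneg (sq_nonneg δ) (dotProduct_self_nonneg_real v)]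
    simp [hby]
  · obtain ⟨H, hHx, hH⟩ := exists_interpolation F A hx (y - θc *ᵥ x) hxy
    have h := hb _ (hmem H hH) x
    rwa [add_mulVec, hHx, add_sub_cancel] at h

/-- The worst-case norm over a nonempty set is the least upper bound `δ ≥ 0` if there is one, and
`⊤` otherwise. -/
lemma worstNorm_eq_isLeast_or_eq_top (φ : Fin k → EuclideanSpace ℝ (Fin n) → ℝ)
    (z : EuclideanSpace ℝ (Fin n)) {Θ : Set (Matrix (Fin k) (Fin m) ℝ)} (hΘ : Θ.Nonempty)
    {S : Set ℝ} (hS : S = {δ | 0 ≤ δ ∧ ∀ θ ∈ Θ, ‖paramFun φ θ z‖ ≤ δ}) :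
    (∃ δ : ℝ, IsLeast S δ ∧ worstNorm φ z Θ = (δ : EReal)) ∨
      (S = ∅ ∧ worstNorm φ z Θ = ⊤) := by
  obtain ⟨θ₀, hθ₀⟩ := hΘ
  have hle : ∀ θ ∈ Θ, ((‖paramFun φ θ z‖ : ℝ) : EReal) ≤ worstNorm φ z Θ := fun θ hθ =>
    le_iSup₂_of_le θ hθ le_rfl
  have h0 : (0 : EReal) ≤ worstNorm φ z Θ :=
    le_trans (by exact_mod_cast norm_nonneg _) (hle θ₀ hθ₀)
  have hub : ∀ δ ∈ S, worstNorm φ z Θ ≤ (δ : EReal) := by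
    rintro δ hδ
    rw [hS] at hδ
    exact iSup₂_le fun θ hθ => by exact_mod_cast hδ.2 θ hθ
  induction hw : worstNorm φ z Θ with
  | bot => simp [hw] at h0
  | coe δ =>
    left
    rw [hw] at h0 hle hub
    refine ⟨δ, ⟨?_, fun ε hε => by exact_mod_cast hub ε hε⟩, rfl⟩
    rw [hS]
    exact ⟨by exact_mod_cast h0, fun θ hθ => by exact_mod_cast hle θ hθ⟩
  | top =>
    refine Or.inr ⟨Set.eq_empty_of_forall_notMem fun δ hδ => ?_, rfl⟩
    have := hub δ hδ
    simp [hw] at this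

end LMI

end CautiousOpt

open CautiousOpt Matrix in
theorem mainTheorem2 {n k m T : ℕ}
    (φ : Fin k → EuclideanSpace ℝ (Fin n) → ℝ)
    (zs : Fin T → EuclideanSpace ℝ (Fin n))
    (P : Matrix (Fin m ⊕ Fin T) (Fin m ⊕ Fin T) ℝ)
    (hP : CautiousOpt.IsNoiseModel P)
    (θhat : Matrix (Fin k) (Fin m) ℝ)
    (W Y : Matrix (Fin m) (Fin T) ℝ)
    (hW : Wᵀ ∈ CautiousOpt.qmiSet P)
    (hY : Y = θhatᵀ * CautiousOpt.regressor φ zs + W)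
    (N : Matrix (Fin m ⊕ Fin k) (Fin m ⊕ Fin k) ℝ)
    (hN : N = CautiousOpt.dataMatrix P Y (CautiousOpt.regressor φ zs))
    (hpos : ∃ μ : ℝ, 0 < μ ∧ Module.End.HasEigenvalue (Matrix.toLin' N) μ)
    (z : EuclideanSpace ℝ (Fin n)) :
    (∀ δ : ℝ, 0 ≤ δ →
      ((∀ θ ∈ CautiousOpt.qmiSet N, ‖CautiousOpt.paramFun φ θ z‖ ≤ δ) ↔
        ∃ α : ℝ, 0 ≤ α ∧
          (CautiousOpt.lmiMatrix N (CautiousOpt.basisVec φ z) δ α).PosSemidef)) ∧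
    ((∃ δ : ℝ, IsLeast (CautiousOpt.feasibleSet N (CautiousOpt.basisVec φ z)) δ ∧
        CautiousOpt.worstNorm φ z (CautiousOpt.qmiSet N) = (δ : EReal)) ∨
      (CautiousOpt.feasibleSet N (CautiousOpt.basisVec φ z) = ∅ ∧
        CautiousOpt.worstNorm φ z (CautiousOpt.qmiSet N) = ⊤)) := by
  have hsymm : N.IsSymm := hN ▸ dataMatrix_isSymm hP.symm _ _
  have hne : (qmiSet N).Nonempty := ⟨θhat, by
    rw [hN, hY]
    exact mem_qmiSet_dataMatrix hP.symm hW _⟩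
  have hquad : ∃ v, 0 < v ⬝ᵥ N *ᵥ v := by
    obtain ⟨μ, hμ, hev⟩ := hpos
    obtain ⟨v, hv⟩ := hev.exists_hasEigenvector
    have hNv : N *ᵥ v = μ • v := by simpa using hv.apply_eq_smul
    refine ⟨v, ?_⟩
    rw [hNv, dotProduct_smul, smul_eq_mul]
    exact mul_pos hμ ((dotProduct_self_nonneg_real v).lt_of_ne'
      (mt dotProduct_self_eq_zero.1 hv.2))
  obtain ⟨F, A, θc, hform⟩ := exists_normal_form hP.symm hP.neg
    (posSemidef_iff_real.1 hP.schur).1 Y (regressor φ zs) (hN ▸ hne)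
  rw [← hN] at hform
  have key : ∀ δ : ℝ, 0 ≤ δ → ((∀ θ ∈ qmiSet N, ‖paramFun φ θ z‖ ≤ δ) ↔
      ∃ α : ℝ, 0 ≤ α ∧ (lmiMatrix N (basisVec φ z) δ α).PosSemidef) := by
    intro δ hδ
    simp only [norm_paramFun_le_iff φ _ z hδ, posSemidef_lmiMatrix_iff hsymm]
    constructor
    · intro hb
      obtain ⟨α, hα, h⟩ := exists_nonneg_forall_smul_le
        (costMatrix_isSymm (m := m) (basisVec φ z) δ) hsymm hquad fun v hv => by
          rw [← Sum.elim_comp_inl_inr v] at hv ⊢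
          rw [quad_costMatrix, sub_nonneg]
          exact sq_le_of_forall_mem_qmiSet hsymm hquad hform hb hv
      exact ⟨α, hα, fun x y => quad_costMatrix (basisVec φ z) δ x y ▸ h _⟩
    · rintro ⟨α, hα, h⟩ θ hθ x
      exact sub_nonneg.1
        ((mul_nonneg hα ((mem_qmiSet_iff hsymm θ).1 hθ x)).trans (h x (θ *ᵥ x)))
  refine ⟨key, worstNorm_eq_isLeast_or_eq_top φ z hne ?_⟩
  ext δ
  exact and_congr_right fun hδ => (key δ hδ).symm
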